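/- Let $\mathbb{B}^3$ be the closed unit ball of $\mathbb{E}^3$ centred at the origin. A unit vector $u$ illuminates a point $p$ of the boundary of a convex body $K$ if $p+\lambda u\in\operatorname{int}K$ for some $\lambda>0$. A finite multiset $U$ of unit vectors $m$-fold illuminates $K$ if each boundary point of $K$ is illuminated by at least $m$ members of $U$, counted with multiplicity, and $I^m(K)$ denotes the smallest number of elements, counted with multiplicity, of such a multiset. If $V$ is a countable set of points outside $K$ such that the segment joining any two distinct points of $V$ meets $K$, then $\widehat K(V)=\bigcup_{v\in V}\operatorname{conv}(K\cup\{v\})$ is called the cap body of $K$ with respect to $V$. Let $m\ge 1$ and $n\ge 3$ be integers, and let $V=\{q_1,\dots,q_n,q_{n+1},q_{n+2}\}$, where $$q_i=\left(\sec\frac{\pi}{n}\cos\frac{2i\pi}{n},\ \sec\frac{\pi}{n}\sin\frac{2i\pi}{n},\ 0\right)\qquad(i=1,\dots,n)$$ and $$q_{n+1}=\left(0,0,\sec\frac{(n-2)\pi}{2n}\right),\qquad q_{n+2}=\left(0,0,-\sec\frac{(n-2)\pi}{2n}\right).$$ Then $\widehat{\mathbb{B}^3}(V)$ is a cap body of $\mathbb{B}^3$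 with respect to $V$, and $$I^m\left(\widehat{\mathbb{B}^3}(V)\right)=2m+\left\lceil\frac{mn}{\left\lfloor\frac{n-1}{2}\right\rfloor}\right\rceil.$$ -/

import Mathlib

/-- The direction `u` illuminates the point `p` with respect to `K`: some point `p + t • u`
with `t > 0` lies in the interior of `K`. -/
def Illuminates {E : Type*} [NormedAddCommGroup E] [NormedSpace ℝ E]
    (K : Set E) (u : Metric.sphere (0 : E) 1) (p : E) : Prop :=
  ∃ t : ℝ, 0 < t ∧ p + t • (u : E) ∈ interior K

open Classical in
/-- `K` is `m`-fold illuminated by the multiset `U` of unit vectors: each boundary point of `K` is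
illuminated by at least `m` members of `U`, counted with multiplicity. -/
def IsMultiIlluminated {E : Type*} [NormedAddCommGroup E] [NormedSpace ℝ E]
    (m : ℕ) (K : Set E) (U : Multiset (Metric.sphere (0 : E) 1)) : Prop :=
  ∀ p ∈ frontier K, m ≤ U.countP (fun u => Illuminates K u p)

/-- The `m`-fold illumination number of `K`: the least cardinality (with multiplicity) of a multiset
of directions that illuminates `K` `m`-fold; its value is `⊤` if there is no such multiset. -/
noncomputable def illuminationNumber {E : Type*} [NormedAddCommGroup E] [NormedSpace ℝ E]
    (m : ℕ) (K : Set E) : ℕ∞ :=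
  ⨅ (U : Multiset (Metric.sphere (0 : E) 1)) (_ : IsMultiIlluminated m K U), (U.card : ℕ∞)

/-- The union of the convex hulls of `K ∪ {v}` over the points `v` of `V`. -/
def spikyBody {E : Type*} [NormedAddCommGroup E] [NormedSpace ℝ E] (K V : Set E) : Set E :=
  ⋃ v ∈ V, convexHull ℝ (K ∪ {v})

/-- `C` is the cap body of `K` with respect to `V`: the set `V` is countable and disjoint from `K`,
the segment between any two distinct points of `V` meets `K`, and `C` is the union of the convex
hulls of `K ∪ {v}` for `v ∈ V`. -/
def IsCapBody {E : Type*} [NormedAddCommGroup E] [NormedSpace ℝ E] (K V C : Set E) : Prop :=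
  V.Countable ∧ Disjoint V K ∧
    (∀ v ∈ V, ∀ w ∈ V, v ≠ w → (segment ℝ v w ∩ K).Nonempty) ∧ C = spikyBody K V

/-- The secant function. -/
noncomputable def secant (x : ℝ) : ℝ := 1 / Real.cos x

/-- The `i`-th vertex of the regular `n`-gon circumscribed about the equator of the unit ball. -/
noncomputable def equatorialVertex (n i : ℕ) : EuclideanSpace ℝ (Fin 3) :=
  !₂[secant (Real.pi / n) * Real.cos (2 * i * Real.pi / n),
     secant (Real.pi / n) * Real.sin (2 * i * Real.pi / n), 0]

/-- The `n` equatorial vertices together with the two poles. -/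
noncomputable def bipyramidVertices (n : ℕ) : Set (EuclideanSpace ℝ (Fin 3)) :=
  equatorialVertex n '' Set.Icc 1 n ∪
    {!₂[0, 0, secant (((n : ℝ) - 2) * Real.pi / (2 * n))],
     !₂[0, 0, -secant (((n : ℝ) - 2) * Real.pi / (2 * n))]}

/-!
A cap body of `K` lies in the cone over `K` from each of its vertices, so a direction illuminates a
vertex of the cap body only if it illuminates that vertex with respect to `K`. Conversely, by
convexity, a multiset of directions that `m`-fold illuminates both `K` and all the vertices `m`-fold
illuminates the whole cap body.

For the unit ball, `u` illuminates `sec α • e` exactly when `sin α < -⟪u, e⟫`. So a direction that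
illuminates a pole of the bipyramid illuminates no other vertex, and a direction that illuminates
equatorial vertices illuminates at most `⌊(n - 1) / 2⌋` of them, since these lie within
`π / 2 - π / n` of a fixed longitude. Counting gives the lower bound. It is attained by `m` copies
of each pole together with directions opposite to the centres of consecutive blocks of
`⌊(n - 1) / 2⌋` equatorial vertices: `⌈m n / ⌊(n - 1) / 2⌋⌉` blocks wind around the equator at least
`m` times.
-/

section Counting

variable {α ι : Type*} (U : Multiset α)

lemma countP_le_countP_of_forall_imp {p q : α → Prop} [DecidablePred p] [DecidablePred q]
    (h : ∀ a, p a → q a) : U.countP p ≤ U.countP q := by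
  rw [Multiset.countP_eq_card_filter, Multiset.countP_eq_card_filter]
  exact Multiset.card_le_card (U.monotone_filter_right h)

lemma countP_add_countP_add_countP_le_card {p q r : α → Prop} [DecidablePred p] [DecidablePred q]
    [DecidablePred r] (hpq : ∀ a, p a → ¬ q a) (hpr : ∀ a, p a → ¬ r a)
    (hqr : ∀ a, q a → ¬ r a) : U.countP p + U.countP q + U.countP r ≤ U.card := by
  induction U using Multiset.induction_on with
  | empty => simp
  | cons a U ih =>
    have hpq := hpq a
    have hpr := hpr a
    have hqr := hqr a
    rw [Multiset.countP_cons, Multiset.countP_cons, Multiset.countP_cons, Multiset.card_cons]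
    split_ifs <;> first | omega | tauto

lemma sum_countP_le_mul_countP_exists (s : Finset ι) (R : ι → α → Prop)
    [∀ i, DecidablePred (R i)] {k : ℕ}
    (hk : ∀ a, (s.filter fun i => R i a).card ≤ k) :
    ∑ i ∈ s, U.countP (R i) ≤ k * U.countP fun a => ∃ i ∈ s, R i a := by
  induction U using Multiset.induction_on with
  | empty => simp
  | cons a U ih =>
    have ha : (s.filter fun i => R i a).card ≤ k * if ∃ i ∈ s, R i a then 1 else 0 := by
      split_ifs with h
      · simpa using hk a
      · simpa [Finset.filter_eq_empty_iff] using h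
    simp only [Multiset.countP_cons, Finset.sum_add_distrib, mul_add, ← Finset.card_filter]
    exact add_le_add ih ha

end Counting

section CapBody

variable {E : Type*} [NormedAddCommGroup E] [NormedSpace ℝ E] {K V C : Set E} {m : ℕ}
  {u : Metric.sphere (0 : E) 1}

lemma Illuminates.mono {L : Set E} {p : E} (hKL : K ⊆ L) (h : Illuminates K u p) :
    Illuminates L u p := by
  obtain ⟨t, ht, hp⟩ := h
  exact ⟨t, ht, interior_mono hKL hp⟩

lemma subset_spikyBody (hV : V.Nonempty) : K ⊆ spikyBody K V := by
  obtain ⟨v, hv⟩ := hV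
  exact (Set.subset_union_left.trans (subset_convexHull ℝ _)).trans
    (Set.subset_biUnion_of_mem (u := fun v => convexHull ℝ (K ∪ {v})) hv)

lemma convexHull_union_singleton_eq_image (hK : Convex ℝ K) (hne : K.Nonempty) (v : E) :
    convexHull ℝ (K ∪ {v}) =
      (fun q : ℝ × E => (1 - q.1) • q.2 + q.1 • v) '' Set.Icc 0 1 ×ˢ K := by
  rw [Set.union_singleton, convexHull_insert hne, hK.convexHull_eq, convexJoin_singleton_left]
  ext x
  simp only [segment_symm ℝ v, segment_eq_image, Set.mem_iUnion, Set.mem_image, Prod.exists,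
    Set.mem_prod]
  constructor
  · rintro ⟨b, hb, s, hs, rfl⟩
    exact ⟨s, b, ⟨hs, hb⟩, rfl⟩
  · rintro ⟨s, b, ⟨hs, hb⟩, rfl⟩
    exact ⟨b, hb, s, hs, rfl⟩

lemma isCompact_spikyBody (hK : Convex ℝ K) (hKc : IsCompact K) (hne : K.Nonempty)
    (hV : V.Finite) : IsCompact (spikyBody K V) := by
  refine hV.isCompact_biUnion fun v _ => ?_
  rw [convexHull_union_singleton_eq_image hK hne]
  exact (isCompact_Icc.prod hKc).image (by fun_prop)

lemma Illuminates.combo (hK : Convex ℝ K) {v b : E} (hv : Illuminates K u v) (hb : b ∈ K)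
    {s : ℝ} (hs : 0 < s) (hs1 : s ≤ 1) : Illuminates K u ((1 - s) • b + s • v) := by
  obtain ⟨t, ht, hvt⟩ := hv
  refine ⟨s * t, mul_pos hs ht, ?_⟩
  have heq : (1 - s) • b + s • v + (s * t) • (u : E) = (1 - s) • b + s • (v + t • (u : E)) := by
    module
  rw [heq]
  exact hK.combo_self_interior_mem_interior hb hvt (sub_nonneg.2 hs1) hs (sub_add_cancel 1 s)

open Classical in
lemma isMultiIlluminated_spikyBody (hK : Convex ℝ K) (hKc : IsCompact K) (hne : K.Nonempty)
    (hV : V.Finite) (hVne : V.Nonempty) {U : Multiset (Metric.sphere (0 : E) 1)}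
    (hUK : IsMultiIlluminated m K U) (hUV : ∀ v ∈ V, m ≤ U.countP fun u => Illuminates K u v) :
    IsMultiIlluminated m (spikyBody K V) U := by
  intro p hp
  have hKS := subset_spikyBody (K := K) hVne
  have hpS := (isCompact_spikyBody hK hKc hne hV).isClosed.frontier_subset hp
  obtain ⟨v, hv, hpv⟩ := Set.mem_iUnion₂.1 hpS
  rw [convexHull_union_singleton_eq_image hK hne] at hpv
  obtain ⟨⟨s, b⟩, ⟨⟨hs0, hs1⟩, hb⟩, rfl⟩ := hpv
  rcases hs0.eq_or_lt with rfl | hs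
  · simp only [sub_zero, one_smul, zero_smul, add_zero] at hp ⊢
    have hbK : b ∈ frontier K := ⟨subset_closure hb, fun hi => hp.2 (interior_mono hKS hi)⟩
    exact (hUK b hbK).trans (countP_le_countP_of_forall_imp U fun _ hu => hu.mono hKS)
  · exact (hUV v hv).trans (countP_le_countP_of_forall_imp U fun _ hu =>
      (hu.combo hK hb hs hs1).mono hKS)

/-- The cone with apex `v` spanned by `K`: the union of the rays from `v` through the points of
`K`. A cap body of `K` lies in the cone over `K` from each of its vertices. -/
def coneFrom (v : E) (K : Set E) : Set E :=
  {x | ∃ s : ℝ, 0 ≤ s ∧ ∃ y ∈ K, x - v = s • (y - v)}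

lemma convex_coneFrom (hK : Convex ℝ K) (v : E) : Convex ℝ (coneFrom v K) := by
  rintro x ⟨s, hs, x', hx', hxv⟩ y ⟨t, ht, y', hy', hyv⟩ a b ha hb hab
  obtain ⟨z, hz, hzeq⟩ := hK.exists_mem_add_smul_eq hx' hy' (mul_nonneg ha hs) (mul_nonneg hb ht)
  refine ⟨a * s + b * t, by positivity, z, hz, ?_⟩
  calc a • x + b • y - v = a • (x - v) + b • (y - v) := by
        obtain rfl := eq_sub_of_add_eq hab
        module
    _ = ((a * s) • x' + (b * t) • y') - (a * s + b * t) • v := by rw [hxv, hyv]; module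
    _ = (a * s + b * t) • (z - v) := by rw [← hzeq, smul_sub]

lemma subset_coneFrom (v : E) : K ⊆ coneFrom v K :=
  fun x hx => ⟨1, zero_le_one, x, hx, (one_smul ℝ _).symm⟩

lemma self_mem_coneFrom (hne : K.Nonempty) (v : E) : v ∈ coneFrom v K := by
  obtain ⟨y, hy⟩ := hne
  exact ⟨0, le_rfl, y, hy, by simp⟩

lemma mem_coneFrom_of_segment_inter {v w : E} (hv : v ∉ K) (h : (segment ℝ v w ∩ K).Nonempty) :
    w ∈ coneFrom v K := by
  obtain ⟨y, hy, hyK⟩ := h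
  rw [segment_eq_image'] at hy
  obtain ⟨t, ⟨ht0, -⟩, rfl⟩ := hy
  have ht : t ≠ 0 := by
    rintro rfl
    exact hv (by simpa using hyK)
  refine ⟨t⁻¹, inv_nonneg.2 ht0, _, hyK, ?_⟩
  rw [add_sub_cancel_left, inv_smul_smul₀ ht]

lemma IsCapBody.subset_coneFrom (h : IsCapBody K V C) (hK : Convex ℝ K) (hne : K.Nonempty) {v : E}
    (hv : v ∈ V) : C ⊆ coneFrom v K := by
  obtain ⟨-, hdisj, hseg, rfl⟩ := h
  refine Set.iUnion₂_subset fun w hw => convexHull_min ?_ (convex_coneFrom hK v)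
  rw [Set.union_singleton, Set.insert_subset_iff]
  refine ⟨?_, _root_.subset_coneFrom v⟩
  obtain rfl | hvw := eq_or_ne v w
  · exact self_mem_coneFrom hne v
  · exact mem_coneFrom_of_segment_inter (Set.disjoint_left.1 hdisj hv) (hseg v hv w hw hvw)

lemma exists_pos_sub_smul_mem_of_mem_interior {x : E} (hx : x ∈ interior K) (d : E) :
    ∃ ε : ℝ, 0 < ε ∧ x - ε • d ∈ K := by
  have hcont : Continuous fun ε : ℝ => x - ε • d := by fun_prop
  have htend : Filter.Tendsto (fun ε : ℝ => x - ε • d) (nhdsWithin 0 (Set.Ioi 0)) (nhds x) := by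
    simpa using (hcont.tendsto 0).mono_left nhdsWithin_le_nhds
  obtain ⟨ε, hεK, hε⟩ := ((htend.eventually (mem_interior_iff_mem_nhds.1 hx)).and
    self_mem_nhdsWithin).exists
  exact ⟨ε, hε, hεK⟩

lemma exists_pos_smul_of_mem_interior_coneFrom (hK : Convex ℝ K) (hint : (interior K).Nonempty)
    {v x : E} (hx : x ∈ interior (coneFrom v K)) :
    ∃ c : ℝ, 0 < c ∧ ∃ y ∈ interior K, x - v = c • (y - v) := by
  obtain ⟨z, hz⟩ := hint
  -- Moving `x` slightly against `z - v` stays in the cone; moving back mixes in `z`.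
  obtain ⟨ε, hε, s, hs, y, hy, hxy⟩ := exists_pos_sub_smul_mem_of_mem_interior hx (z - v)
  have hc : 0 < s + ε := by positivity
  refine ⟨s + ε, hc, (s / (s + ε)) • y + (ε / (s + ε)) • z,
    hK.combo_self_interior_mem_interior hy hz (by positivity) (by positivity) (by field_simp), ?_⟩
  calc x - v = (x - ε • (z - v) - v) + ε • (z - v) := by module
    _ = s • y + ε • z - (s + ε) • v := by rw [hxy]; module
    _ = _ := by
      rw [smul_sub, smul_add, smul_smul, smul_smul, mul_div_cancel₀ _ hc.ne',
        mul_div_cancel₀ _ hc.ne']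

lemma IsCapBody.notMem_interior (h : IsCapBody K V C) (hK : Convex ℝ K)
    (hint : (interior K).Nonempty) {v : E} (hv : v ∈ V) : v ∉ interior C := fun hvC => by
  obtain ⟨c, hc, y, hy, hvy⟩ := exists_pos_smul_of_mem_interior_coneFrom hK hint
    (interior_mono (h.subset_coneFrom hK (hint.mono interior_subset) hv) hvC)
  rw [sub_self, eq_comm, smul_eq_zero_iff_right hc.ne', sub_eq_zero] at hvy
  exact Set.disjoint_left.1 h.2.1 hv (hvy ▸ interior_subset hy)

lemma IsCapBody.mem_frontier (h : IsCapBody K V C) (hK : Convex ℝ K)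
    (hint : (interior K).Nonempty) {v : E} (hv : v ∈ V) : v ∈ frontier C := by
  refine ⟨subset_closure ?_, h.notMem_interior hK hint hv⟩
  rw [h.2.2.2]
  exact Set.mem_biUnion hv (subset_convexHull ℝ _ (by simp))

lemma IsCapBody.illuminates_of_illuminates (h : IsCapBody K V C) (hK : Convex ℝ K)
    (hint : (interior K).Nonempty) {v : E} (hv : v ∈ V) (hu : Illuminates C u v) :
    Illuminates K u v := by
  obtain ⟨t, ht, hvt⟩ := hu
  obtain ⟨c, hc, y, hy, hty⟩ := exists_pos_smul_of_mem_interior_coneFrom hK hint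
    (interior_mono (h.subset_coneFrom hK (hint.mono interior_subset) hv) hvt)
  refine ⟨t / c, div_pos ht hc, ?_⟩
  rw [add_sub_cancel_left] at hty
  rwa [div_eq_inv_mul, mul_smul, hty, inv_smul_smul₀ hc.ne', add_sub_cancel]

open Classical in
lemma IsCapBody.le_countP_illuminates (h : IsCapBody K V C) (hK : Convex ℝ K)
    (hint : (interior K).Nonempty) {U : Multiset (Metric.sphere (0 : E) 1)}
    (hU : IsMultiIlluminated m C U) {v : E} (hv : v ∈ V) :
    m ≤ U.countP fun u => Illuminates K u v :=
  (hU v (h.mem_frontier hK hint hv)).trans <| countP_le_countP_of_forall_imp U fun _ =>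
    h.illuminates_of_illuminates hK hint hv

end CapBody

section UnitBall

open Real Metric

variable {E : Type*} [NormedAddCommGroup E] [InnerProductSpace ℝ E] {u e f : sphere (0 : E) 1}
  {α β : ℝ}

lemma illuminates_closedBall_iff {p : E} :
    Illuminates (closedBall 0 1) u p ↔ ∃ t : ℝ, 0 < t ∧ ‖p + t • (u : E)‖ < 1 := by
  simp only [Illuminates, interior_closedBall (0 : E) one_ne_zero, mem_ball_zero_iff]

lemma one_lt_secant (hα : α ∈ Set.Ioo 0 (π / 2)) : 1 < secant α := by
  have hcos : 0 < cos α := cos_pos_of_mem_Ioo ⟨by linarith [hα.1, pi_pos], hα.2⟩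
  rw [secant, one_lt_div hcos, ← cos_zero]
  exact cos_lt_cos_of_nonneg_of_le_pi_div_two le_rfl hα.2.le hα.1

lemma secant_smul_notMem_closedBall (hα : α ∈ Set.Ioo 0 (π / 2)) :
    secant α • (e : E) ∉ closedBall 0 1 := by
  rw [mem_closedBall_zero_iff, norm_smul, norm_eq_of_mem_sphere, mul_one, not_le]
  exact (one_lt_secant hα).trans_le (le_abs_self _)

lemma norm_secant_smul_add_smul_lt_one_iff (hα : 0 < cos α) (t : ℝ) :
    ‖secant α • (e : E) + t • (u : E)‖ < 1 ↔
      sin α ^ 2 + (t * cos α + inner ℝ (u : E) e) ^ 2 < inner ℝ (u : E) e ^ 2 := by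
  have hsq : ‖secant α • (e : E) + t • (u : E)‖ ^ 2 * cos α ^ 2 =
      1 + 2 * (t * cos α) * inner ℝ (u : E) e + (t * cos α) ^ 2 := by
    rw [norm_add_sq_real, norm_smul, norm_smul, real_inner_smul_left, real_inner_smul_right,
      real_inner_comm, norm_eq_of_mem_sphere, norm_eq_of_mem_sphere, norm_eq_abs, norm_eq_abs,
      mul_one, mul_one, sq_abs, sq_abs, secant]
    field_simp
  rw [← sq_lt_one_iff₀ (norm_nonneg _), ← mul_lt_mul_iff_left₀ (pow_pos hα 2), one_mul, hsq,
    sin_sq]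
  constructor <;> intro h <;> linarith

lemma illuminates_closedBall_secant_smul_iff (hα : α ∈ Set.Ico 0 (π / 2)) :
    Illuminates (closedBall 0 1) u (secant α • (e : E)) ↔ sin α < -inner ℝ (u : E) e := by
  have hcos : 0 < cos α := cos_pos_of_mem_Ioo ⟨by linarith [hα.1, pi_pos], hα.2⟩
  have hsin : 0 ≤ sin α := sin_nonneg_of_nonneg_of_le_pi hα.1 (by linarith [hα.2, pi_pos])
  simp only [illuminates_closedBall_iff, norm_secant_smul_add_smul_lt_one_iff hcos]
  constructor
  · rintro ⟨t, ht, hlt⟩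
    have htc : 0 < t * cos α := mul_pos ht hcos
    have hneg : 0 < -inner ℝ (u : E) e := by nlinarith [sq_nonneg (sin α)]
    refine lt_of_pow_lt_pow_left₀ 2 hneg.le ?_
    rw [neg_sq]
    exact lt_of_le_of_lt (le_add_of_nonneg_right (sq_nonneg _)) hlt
  · intro h
    refine ⟨-inner ℝ (u : E) e / cos α, div_pos (hsin.trans_lt h) hcos, ?_⟩
    rw [div_mul_cancel₀ _ hcos.ne', neg_add_cancel, zero_pow two_ne_zero, add_zero,
      ← neg_sq (inner ℝ (u : E) e)]
    exact pow_lt_pow_left₀ h hsin two_ne_zero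

lemma illuminates_closedBall_coe_iff :
    Illuminates (closedBall 0 1) u (e : E) ↔ inner ℝ (u : E) e < 0 := by
  simpa [secant] using
    illuminates_closedBall_secant_smul_iff (u := u) (e := e) ⟨le_rfl, pi_div_two_pos⟩

lemma Illuminates.closedBall_of_one_le_inner {v : E} (hu : Illuminates (closedBall 0 1) u v)
    (h : 1 ≤ inner ℝ v (e : E)) : Illuminates (closedBall 0 1) u (e : E) := by
  obtain ⟨t, ht, hvt⟩ := illuminates_closedBall_iff.1 hu
  have hlt : inner ℝ (v + t • (u : E)) (e : E) < 1 := by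
    refine (real_inner_le_norm _ _).trans_lt ?_
    rwa [norm_eq_of_mem_sphere, mul_one]
  rw [inner_add_left, real_inner_smul_left] at hlt
  rw [illuminates_closedBall_coe_iff]
  exact neg_of_mul_neg_right (by linarith : t * inner ℝ (u : E) e < 0) ht.le

lemma norm_sin_smul_add_sin_smul_le (hα : 0 ≤ sin α) (hβ : 0 ≤ sin β) (hαβ : 0 ≤ sin (α + β))
    (h : inner ℝ (e : E) f ≤ cos (α + β)) :
    ‖sin β • (e : E) + sin α • (f : E)‖ ≤ sin (α + β) := by
  refine le_of_sq_le_sq ?_ hαβ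
  calc ‖sin β • (e : E) + sin α • (f : E)‖ ^ 2
      = sin α ^ 2 + sin β ^ 2 + 2 * (sin α * sin β) * inner ℝ (e : E) f := by
        rw [norm_add_sq_real, norm_smul, norm_smul, real_inner_smul_left, real_inner_smul_right,
          norm_eq_of_mem_sphere, norm_eq_of_mem_sphere, norm_of_nonneg hα, norm_of_nonneg hβ]
        ring
    _ ≤ sin α ^ 2 + sin β ^ 2 + 2 * (sin α * sin β) * cos (α + β) := by gcongr
    _ = sin (α + β) ^ 2 := by
        rw [cos_add, sin_add]
        linear_combination
          -sin α ^ 2 * sin_sq_add_cos_sq β - sin β ^ 2 * sin_sq_add_cos_sq α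

lemma segment_secant_smul_inter_closedBall (hα : α ∈ Set.Ioo 0 (π / 2))
    (hβ : β ∈ Set.Ioo 0 (π / 2)) (h : inner ℝ (e : E) f ≤ cos (α + β)) :
    (segment ℝ (secant α • (e : E)) (secant β • (f : E)) ∩ closedBall 0 1).Nonempty := by
  have hcα : 0 < cos α := cos_pos_of_mem_Ioo ⟨by linarith [hα.1, pi_pos], hα.2⟩
  have hcβ : 0 < cos β := cos_pos_of_mem_Ioo ⟨by linarith [hβ.1, pi_pos], hβ.2⟩
  have hsα : 0 < sin α := sin_pos_of_pos_of_lt_pi hα.1 (by linarith [hα.2, pi_pos])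
  have hsβ : 0 < sin β := sin_pos_of_pos_of_lt_pi hβ.1 (by linarith [hβ.2, pi_pos])
  have hs : 0 < sin (α + β) :=
    sin_pos_of_pos_of_lt_pi (add_pos hα.1 hβ.1) (by linarith [hα.2, hβ.2])
  refine ⟨(sin (α + β))⁻¹ • (sin β • (e : E) + sin α • (f : E)),
    ⟨sin β * cos α / sin (α + β), sin α * cos β / sin (α + β), by positivity, by positivity,
      ?_, ?_⟩, ?_⟩
  · rw [← add_div, sin_add, div_eq_one_iff_eq (sin_add α β ▸ hs.ne')]
    ring
  · simp only [smul_add, smul_smul, secant]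
    congr 2 <;> field_simp
  · rw [mem_closedBall_zero_iff, norm_smul, norm_inv, norm_of_nonneg hs.le]
    exact inv_mul_le_one_of_le₀ (norm_sin_smul_add_sin_smul_le hsα.le hsβ.le hs.le h) hs.le

lemma not_illuminates_closedBall_of_inner_le (hα : α ∈ Set.Ico 0 (π / 2))
    (hβ : β ∈ Set.Ico 0 (π / 2)) (h : inner ℝ (e : E) f ≤ -cos (α + β))
    (hu : Illuminates (closedBall 0 1) u (secant α • (e : E))) :
    ¬ Illuminates (closedBall 0 1) u (secant β • (f : E)) := by
  have hcα : 0 < cos α := cos_pos_of_mem_Ioo ⟨by linarith [hα.1, pi_pos], hα.2⟩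
  have hcβ : 0 < cos β := cos_pos_of_mem_Ioo ⟨by linarith [hβ.1, pi_pos], hβ.2⟩
  have hs : 0 ≤ sin (α + β) :=
    sin_nonneg_of_nonneg_of_le_pi (add_nonneg hα.1 hβ.1) (by linarith [hα.2, hβ.2])
  rw [illuminates_closedBall_secant_smul_iff hα] at hu
  rw [illuminates_closedBall_secant_smul_iff hβ]
  intro hv
  have hsum : π / 2 - α + (π / 2 - β) = π - (α + β) := by ring
  have hnorm : ‖cos β • (e : E) + cos α • (f : E)‖ ≤ sin (α + β) := by
    simpa only [sin_pi_div_two_sub, hsum, sin_pi_sub] using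
      norm_sin_smul_add_sin_smul_le (α := π / 2 - α) (β := π / 2 - β) (e := e) (f := f)
        (by rw [sin_pi_div_two_sub]; exact hcα.le) (by rw [sin_pi_div_two_sub]; exact hcβ.le)
        (by rwa [hsum, sin_pi_sub]) (by rwa [hsum, cos_pi_sub])
  refine lt_irrefl (sin (α + β)) ?_
  calc sin (α + β) = cos β * sin α + cos α * sin β := by rw [sin_add]; ring
    _ < cos β * -inner ℝ (u : E) e + cos α * -inner ℝ (u : E) f := by gcongr
    _ = -inner ℝ (u : E) (cos β • (e : E) + cos α • (f : E)) := by
        rw [inner_add_right, real_inner_smul_right, real_inner_smul_right]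
        ring
    _ ≤ ‖(u : E)‖ * ‖cos β • (e : E) + cos α • (f : E)‖ :=
        (neg_le_abs _).trans (abs_real_inner_le_norm _ _)
    _ ≤ sin (α + β) := by rwa [norm_eq_of_mem_sphere, one_mul]

end UnitBall

section Circle

open Real

variable {n k : ℕ}

lemma exists_int_abs_sub_lt_of_cos_lt_cos {γ θ : ℝ} (hγ : 0 ≤ γ) (h : cos γ < cos θ) :
    ∃ z : ℤ, |θ - z * (2 * π)| < γ := by
  refine ⟨toIocDiv two_pi_pos (-π) θ, ?_⟩
  have hmod : toIocMod two_pi_pos (-π) θ = θ - toIocDiv two_pi_pos (-π) θ * (2 * π) := by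
    rw [toIocMod, zsmul_eq_mul]
  have hmem := toIocMod_mem_Ioc two_pi_pos (-π) θ
  rw [← cos_sub_int_mul_two_pi θ (toIocDiv two_pi_pos (-π) θ), ← hmod,
    ← cos_abs (toIocMod _ _ _)] at h
  rw [← hmod]
  by_contra! hle
  exact h.not_ge (cos_le_cos_of_nonneg_of_le_pi hγ (abs_le.2 ⟨hmem.1.le, by linarith [hmem.2]⟩) hle)

lemma cos_two_mul_pi_div_sub_le (hn : 0 < n) {i j : ℤ} (hij : ¬ i ≡ j [ZMOD n]) :
    cos (2 * i * π / n - 2 * j * π / n) ≤ cos (2 * π / n) := by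
  by_contra! h
  obtain ⟨z, hz⟩ := exists_int_abs_sub_lt_of_cos_lt_cos (by positivity) h
  have hscale : 2 * i * π / n - 2 * j * π / n - z * (2 * π) =
      ((i - j - n * z : ℤ) : ℝ) * (2 * π / n) := by
    push_cast
    field_simp
  rw [hscale, abs_mul, abs_of_pos (by positivity : 0 < 2 * π / n),
    mul_lt_iff_lt_one_left (by positivity)] at hz
  have hzero : i - j - n * z = 0 := Int.abs_lt_one_iff.1 (by exact_mod_cast hz)
  exact hij (Int.modEq_iff_dvd.2 ⟨-z, by linarith⟩)

lemma card_Ioo_floor_ceil_lt {a b : ℝ} (hab : a ≤ b) :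
    ((Finset.Ioo ⌊a⌋ ⌈b⌉).card : ℝ) < b - a + 1 := by
  have hb := Int.ceil_lt_add_one b
  have ha := Int.sub_one_lt_floor a
  rw [Int.card_Ioo, ← Int.cast_natCast, Int.toNat_eq_max, Int.cast_max, max_lt_iff]
  push_cast
  constructor <;> linarith

lemma card_filter_cos_lt_cos_lt {γ : ℝ} (hn : 0 < n) (hγ : 0 ≤ γ) (φ : ℝ) :
    (((Finset.Icc 1 n).filter fun i : ℕ => cos γ < cos (2 * i * π / n - φ)).card : ℝ) <
      n * γ / π + 1 := by
  have hn' : (0 : ℝ) < n := by exact_mod_cast hn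
  have hlift (i : ℕ) (hi : cos γ < cos (2 * i * π / n - φ)) :
      ∃ j ∈ Finset.Ioo ⌊n * (φ - γ) / (2 * π)⌋ ⌈n * (φ + γ) / (2 * π)⌉, (n : ℤ) ∣ i - j := by
    obtain ⟨z, hz⟩ := exists_int_abs_sub_lt_of_cos_lt_cos hγ hi
    refine ⟨i - n * z, ?_, z, by ring⟩
    have hangle : 2 * i * π / n - φ - z * (2 * π) = 2 * π * (i - n * z) / n - φ := by
      field_simp
      ring
    rw [hangle, abs_sub_lt_iff, sub_lt_iff_lt_add', sub_lt_comm, div_lt_iff₀ hn',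
      lt_div_iff₀ hn'] at hz
    rw [Finset.mem_Ioo, Int.floor_lt, Int.lt_ceil, div_lt_iff₀ two_pi_pos, lt_div_iff₀ two_pi_pos]
    push_cast
    constructor <;> linarith [hz.1, hz.2]
  choose! f hf hdvd using hlift
  have hcard := Finset.card_le_card_of_injOn f
    (s := (Finset.Icc 1 n).filter fun i : ℕ => cos γ < cos (2 * i * π / n - φ))
    (fun i hi => hf i (Finset.mem_filter.1 hi).2) fun i hi i' hi' hii => by
      simp only [Finset.coe_filter, Finset.mem_Icc, Set.mem_ofPred_eq] at hi hi'
      have hsub := dvd_sub (hdvd i hi.2) (hdvd i' hi'.2)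
      rw [hii, sub_sub_sub_cancel_right] at hsub
      have := Int.eq_zero_of_abs_lt_dvd hsub (by rw [abs_lt]; omega)
      omega
  calc _ ≤ ((Finset.Ioo ⌊n * (φ - γ) / (2 * π)⌋ ⌈n * (φ + γ) / (2 * π)⌉).card : ℝ) := by
        exact_mod_cast hcard
    _ < n * (φ + γ) / (2 * π) - n * (φ - γ) / (2 * π) + 1 :=
        card_Ioo_floor_ceil_lt (by gcongr; linarith)
    _ = n * γ / π + 1 := by field_simp; ring

lemma card_filter_sin_lt_cos_le (hn : 2 ≤ n) (φ : ℝ) :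
    ((Finset.Icc 1 n).filter fun i : ℕ => sin (π / n) < cos (2 * i * π / n - φ)).card ≤
      (n - 1) / 2 := by
  have hn' : (2 : ℝ) ≤ n := by exact_mod_cast hn
  have hγ : 0 ≤ π / 2 - π / n := sub_nonneg.2 (by gcongr)
  have hlt := card_filter_cos_lt_cos_lt (by omega : 0 < n) hγ φ
  have hhalf : n * (π / 2 - π / n) / π + 1 = n / 2 := by field_simp; ring
  rw [cos_pi_div_two_sub, hhalf, lt_div_iff₀ two_pos] at hlt
  have hlt_nat := (mod_cast hlt :
    ((Finset.Icc 1 n).filter fun i : ℕ => sin (π / n) < cos (2 * i * π / n - φ)).card * 2 < n)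
  omega

lemma le_card_filter_exists_div_eq {m N : ℕ} (hk : 0 < k) (hkn : k ≤ n) (hN : m * n ≤ N * k)
    (i : ℤ) [DecidablePred fun j : ℕ => ∃ l : ℕ, l / k = j ∧ (l : ℤ) ≡ i [ZMOD n]] :
    m ≤ ((Finset.range N).filter fun j : ℕ =>
      ∃ l : ℕ, l / k = j ∧ (l : ℤ) ≡ i [ZMOD n]).card := by
  obtain ⟨a, han, hai⟩ := Int.existsUnique_equiv_nat i
    (Int.natCast_pos.2 (hk.trans_le hkn))
  have hmono : StrictMono fun t : ℕ => (a + t * n) / k := by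
    refine strictMono_nat_of_lt_succ fun t => ?_
    calc (a + t * n) / k < (a + t * n + k) / k := by rw [Nat.add_div_right _ hk]; omega
      _ ≤ (a + (t + 1) * n) / k := Nat.div_le_div_right (by linarith)
  conv_lhs => rw [← Finset.card_range m]
  refine Finset.card_le_card_of_injOn _ (fun t ht => ?_) hmono.injective.injOn
  rw [Finset.mem_coe, Finset.mem_filter, Finset.mem_range, Nat.div_lt_iff_lt_mul hk]
  refine ⟨?_, a + t * n, rfl, ?_⟩
  · calc a + t * n < (t + 1) * n := by linarith
      _ ≤ m * n := Nat.mul_le_mul_right _ (Finset.mem_range.1 ht)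
      _ ≤ N * k := hN
  · push_cast
    exact (Int.add_mul_emod_self_right _ _ _).trans hai

/-- The angular position of the centre of the `j`-th block of `k` consecutive vertices of the
regular `n`-gon whose `l`-th vertex lies at the angle `2 * l * π / n`; the block consists of the
vertices `j * k, …, j * k + k - 1`. -/
noncomputable def blockAngle (n k j : ℕ) : ℝ := (2 * (j * k) + k - 1) * (π / n)

lemma abs_blockAngle_div_sub_le (hk : 0 < k) (l : ℕ) :
    |blockAngle n k (l / k) - 2 * l * π / n| ≤ (k - 1) * (π / n) := by
  have hdiff : blockAngle n k (l / k) - 2 * l * π / n =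
      (2 * ((l / k : ℕ) * k) + k - 1 - 2 * l) * (π / n) := by
    rw [blockAngle]
    ring
  have hmod : l / k * k + l % k = l := Nat.div_add_mod' l k
  have hle : ((l / k : ℕ) * k : ℝ) ≤ l := by exact_mod_cast (by omega : l / k * k ≤ l)
  have hlt : (l : ℝ) + 1 ≤ (l / k : ℕ) * k + k := by
    exact_mod_cast (by have := Nat.mod_lt l hk; omega : l + 1 ≤ l / k * k + k)
  rw [hdiff, abs_mul, abs_of_nonneg (by positivity : 0 ≤ π / n)]
  gcongr
  rw [abs_le]
  constructor <;> linarith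

lemma sin_lt_cos_blockAngle_div_sub (hk : 0 < k) (hkn : 2 * k < n) (l : ℕ) :
    sin (π / n) < cos (blockAngle n k (l / k) - 2 * l * π / n) := by
  have hn : 0 < (n : ℝ) := by exact_mod_cast (by omega : 0 < n)
  have hkn' : 2 * (k : ℝ) < n := by exact_mod_cast hkn
  have hα : 0 < π / n := by positivity
  rw [← cos_pi_div_two_sub, ← cos_abs (blockAngle _ _ _ - _)]
  refine cos_lt_cos_of_nonneg_of_le_pi (abs_nonneg _) (by linarith [pi_pos]) ?_
  refine (abs_blockAngle_div_sub_le hk l).trans_lt ?_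
  calc (k - 1) * (π / n) < (n / 2 - 1) * (π / n) := by gcongr; linarith
    _ = π / 2 - π / n := by field_simp

lemma cos_sub_two_mul_pi_div_eq_of_modEq (hn : 0 < n) {i l : ℤ} (h : l ≡ i [ZMOD n]) (x : ℝ) :
    cos (x - 2 * l * π / n) = cos (x - 2 * i * π / n) := by
  obtain ⟨c, hc⟩ := h.dvd
  obtain rfl : i = l + n * c := by linarith
  rw [← cos_sub_int_mul_two_pi (x - 2 * l * π / n) c]
  congr 1
  push_cast
  field_simp
  ring

open Classical in
lemma le_card_filter_sin_lt_cos_blockAngle_sub {m N : ℕ} (hk : 0 < k) (hkn : 2 * k < n)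
    (hN : m * n ≤ N * k) (i : ℤ) :
    m ≤ ((Finset.range N).filter fun j : ℕ =>
      sin (π / n) < cos (blockAngle n k j - 2 * i * π / n)).card := by
  refine (le_card_filter_exists_div_eq hk (by omega) hN i).trans
    (Finset.card_le_card (Finset.monotone_filter_right _ ?_))
  rintro _ - ⟨l, rfl, hl⟩
  rw [← cos_sub_two_mul_pi_div_eq_of_modEq (by omega) hl]
  exact_mod_cast sin_lt_cos_blockAngle_div_sub hk hkn l

end Circle

section Space

open Real Metric

/-- The point of the equator of the unit sphere at longitude `θ`. -/
noncomputable def equatorPoint (θ : ℝ) : sphere (0 : EuclideanSpace ℝ (Fin 3)) 1 :=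
  ⟨!₂[cos θ, sin θ, 0], by simp [EuclideanSpace.norm_eq, Fin.sum_univ_three]⟩

/-- The pole of the unit sphere in the upper (`σ = 1`) or lower (`σ = -1`) half-space. -/
noncomputable def pole (σ : ℤˣ) : sphere (0 : EuclideanSpace ℝ (Fin 3)) 1 :=
  ⟨!₂[0, 0, ((σ : ℤ) : ℝ)], by
    obtain rfl | rfl := Int.units_eq_one_or σ <;>
      simp [EuclideanSpace.norm_eq, Fin.sum_univ_three]⟩

lemma inner_equatorPoint_equatorPoint (θ φ : ℝ) :
    inner ℝ (equatorPoint θ : EuclideanSpace ℝ (Fin 3)) (equatorPoint φ) = cos (θ - φ) := by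
  simp [equatorPoint, PiLp.inner_apply, Fin.sum_univ_three, cos_sub, mul_comm]

lemma inner_pole_right (x : EuclideanSpace ℝ (Fin 3)) (σ : ℤˣ) :
    inner ℝ x (pole σ : EuclideanSpace ℝ (Fin 3)) = (σ : ℤ) * x 2 := by
  simp [pole, PiLp.inner_apply, Fin.sum_univ_three]

lemma inner_equatorPoint_pole (θ : ℝ) (σ : ℤˣ) :
    inner ℝ (equatorPoint θ : EuclideanSpace ℝ (Fin 3)) (pole σ) = 0 := by
  simp [inner_pole_right, equatorPoint]

lemma pole_neg (σ : ℤˣ) : pole (-σ) = -pole σ := by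
  ext k
  fin_cases k <;> simp [pole]

lemma inner_pole_pole_of_ne {σ τ : ℤˣ} (h : σ ≠ τ) :
    inner ℝ (pole σ : EuclideanSpace ℝ (Fin 3)) (pole τ) = -1 := by
  rw [Int.units_ne_iff_eq_neg.1 h, pole_neg, coe_neg_sphere, inner_neg_left,
    real_inner_self_eq_norm_sq, norm_eq_of_mem_sphere, one_pow]

lemma exists_eq_smul_equatorPoint_add_smul_pole (x : EuclideanSpace ℝ (Fin 3)) :
    ∃ ρ φ : ℝ, 0 ≤ ρ ∧ x = ρ • (equatorPoint φ : EuclideanSpace ℝ (Fin 3)) + x 2 • (pole 1 : _) ∧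
      ‖x‖ ^ 2 = ρ ^ 2 + x 2 ^ 2 := by
  have hx : x = ‖(⟨x 0, x 1⟩ : ℂ)‖ •
      (equatorPoint (Complex.arg ⟨x 0, x 1⟩) : EuclideanSpace ℝ (Fin 3)) + x 2 • (pole 1 : _) := by
    ext k
    fin_cases k <;> simp [equatorPoint, pole]
  refine ⟨_, _, norm_nonneg _, hx, ?_⟩
  conv_lhs => rw [hx]
  rw [norm_add_sq_real, norm_smul, norm_smul, real_inner_smul_left, real_inner_smul_right,
    inner_equatorPoint_pole, norm_eq_of_mem_sphere, norm_eq_of_mem_sphere, norm_norm, norm_eq_abs,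
    mul_one, mul_one, sq_abs, mul_zero, mul_zero, mul_zero, add_zero]

lemma exists_eq_equatorPoint {x : EuclideanSpace ℝ (Fin 3)} (hx : ‖x‖ = 1) (hx2 : x 2 = 0) :
    ∃ φ, x = equatorPoint φ := by
  obtain ⟨ρ, φ, hρ, hxφ, hnorm⟩ := exists_eq_smul_equatorPoint_add_smul_pole x
  rw [hx, hx2, zero_pow two_ne_zero, add_zero, one_pow, eq_comm,
    pow_eq_one_iff_of_nonneg hρ two_ne_zero] at hnorm
  exact ⟨φ, by rw [hxφ, hnorm, hx2, one_smul, zero_smul, add_zero]⟩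

lemma exists_forall_lt_cos_of_lt_inner_equatorPoint {x : EuclideanSpace ℝ (Fin 3)} (hx : ‖x‖ ≤ 1) :
    ∃ φ, ∀ s θ : ℝ, 0 ≤ s → s < inner ℝ x (equatorPoint θ : EuclideanSpace ℝ (Fin 3)) →
      s < cos (θ - φ) := by
  obtain ⟨ρ, φ, hρ, hxφ, hnorm⟩ := exists_eq_smul_equatorPoint_add_smul_pole x
  have hρ1 : ρ ≤ 1 := by
    refine le_trans (le_of_sq_le_sq ?_ (norm_nonneg x)) hx
    rw [hnorm]
    exact le_add_of_nonneg_right (sq_nonneg _)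
  refine ⟨φ, fun s θ hs hlt => ?_⟩
  rw [hxφ, inner_add_left, real_inner_smul_left, real_inner_smul_left,
    inner_equatorPoint_equatorPoint, real_inner_comm, inner_equatorPoint_pole, mul_zero, add_zero,
    ← cos_neg, neg_sub] at hlt
  exact hlt.trans_le (mul_le_of_le_one_left (pos_of_mul_pos_right (hs.trans_lt hlt) hρ).le hρ1)

lemma card_filter_sin_lt_neg_inner_equatorPoint_le {n : ℕ} (hn : 2 ≤ n)
    (u : sphere (0 : EuclideanSpace ℝ (Fin 3)) 1) :
    ((Finset.Icc 1 n).filter fun i : ℕ => sin (π / n) <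
      -inner ℝ (u : EuclideanSpace ℝ (Fin 3)) (equatorPoint (2 * i * π / n))).card ≤
        (n - 1) / 2 := by
  have hn' : (1 : ℝ) ≤ n := by exact_mod_cast (by omega : 1 ≤ n)
  obtain ⟨φ, hφ⟩ := exists_forall_lt_cos_of_lt_inner_equatorPoint
    (x := -(u : EuclideanSpace ℝ (Fin 3))) (by simp)
  refine (Finset.card_le_card (Finset.monotone_filter_right _ fun i _ hi => ?_)).trans
    (card_filter_sin_lt_cos_le hn φ)
  refine hφ _ _ (sin_nonneg_of_nonneg_of_le_pi (by positivity) (div_le_self pi_pos.le hn')) ?_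
  rwa [inner_neg_left]

end Space

section Bipyramid

open Real Metric

variable {m n : ℕ} {u : sphere (0 : EuclideanSpace ℝ (Fin 3)) 1}

lemma pi_div_mem_Ioo (hn : 2 < n) : π / n ∈ Set.Ioo 0 (π / 2) := by
  have hn' : (2 : ℝ) < n := by exact_mod_cast hn
  exact ⟨by positivity, by gcongr⟩

lemma pi_div_two_sub_pi_div_mem_Ioo (hn : 2 < n) : π / 2 - π / n ∈ Set.Ioo 0 (π / 2) :=
  ⟨sub_pos.2 (pi_div_mem_Ioo hn).2, sub_lt_self _ (pi_div_mem_Ioo hn).1⟩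

/-- The apex of the bipyramid above (`σ = 1`) or below (`σ = -1`) the equatorial plane: the paper's
`q_{n+1}` and `q_{n+2}`, since `(n - 2)π / (2n) = π / 2 - π / n`. -/
noncomputable def polarVertex (n : ℕ) (σ : ℤˣ) : EuclideanSpace ℝ (Fin 3) :=
  secant (π / 2 - π / n) • (pole σ : EuclideanSpace ℝ (Fin 3))

lemma equatorialVertex_eq_smul (n i : ℕ) :
    equatorialVertex n i = secant (π / n) •
      (equatorPoint (2 * i * π / n) : EuclideanSpace ℝ (Fin 3)) := by
  ext k
  fin_cases k <;> simp [equatorialVertex, equatorPoint]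

lemma bipyramidVertices_eq (hn : 0 < n) :
    bipyramidVertices n = equatorialVertex n '' Set.Icc 1 n ∪ Set.range (polarVertex n) := by
  have hangle : ((n : ℝ) - 2) * π / (2 * n) = π / 2 - π / n := by field_simp
  have hpolar (σ : ℤˣ) : polarVertex n σ = !₂[0, 0, secant (π / 2 - π / n) * (σ : ℤ)] := by
    ext k
    fin_cases k <;> simp [polarVertex, pole]
  have hrange : Set.range (polarVertex n) = {polarVertex n 1, polarVertex n (-1)} := by
    rw [← Set.image_univ, ← Set.image_pair]
    congr
    ext σ
    simpa using Int.units_eq_one_or σ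
  rw [bipyramidVertices, hangle, hrange, hpolar, hpolar]
  simp

lemma mem_bipyramidVertices (hn : 0 < n) {v : EuclideanSpace ℝ (Fin 3)} :
    v ∈ bipyramidVertices n ↔
      (∃ i ∈ Set.Icc 1 n, equatorialVertex n i = v) ∨ ∃ σ, polarVertex n σ = v := by
  rw [bipyramidVertices_eq hn, Set.mem_union, Set.mem_image, Set.mem_range]

lemma finite_bipyramidVertices (n : ℕ) : (bipyramidVertices n).Finite :=
  ((Set.finite_Icc 1 n).image _).union (Set.toFinite _)

lemma illuminates_closedBall_equatorialVertex_iff (hn : 2 < n) (i : ℕ) :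
    Illuminates (closedBall 0 1) u (equatorialVertex n i) ↔ sin (π / n) <
      -inner ℝ (u : EuclideanSpace ℝ (Fin 3)) (equatorPoint (2 * i * π / n)) := by
  rw [equatorialVertex_eq_smul,
    illuminates_closedBall_secant_smul_iff (Set.Ioo_subset_Ico_self (pi_div_mem_Ioo hn))]

lemma segment_equatorialVertex_equatorialVertex_inter_closedBall (hn : 2 < n) {i j : ℕ}
    (hi : i ∈ Set.Icc 1 n) (hj : j ∈ Set.Icc 1 n) (hij : i ≠ j) :
    (segment ℝ (equatorialVertex n i) (equatorialVertex n j) ∩ closedBall 0 1).Nonempty := by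
  have hmod : ¬ (i : ℤ) ≡ j [ZMOD n] := fun h => by
    obtain ⟨hi1, hin⟩ := hi
    obtain ⟨hj1, hjn⟩ := hj
    have := Int.eq_zero_of_abs_lt_dvd h.dvd (by rw [abs_lt]; omega)
    omega
  rw [equatorialVertex_eq_smul, equatorialVertex_eq_smul]
  refine segment_secant_smul_inter_closedBall (pi_div_mem_Ioo hn) (pi_div_mem_Ioo hn) ?_
  rw [inner_equatorPoint_equatorPoint, ← two_mul, ← mul_div_assoc]
  exact_mod_cast cos_two_mul_pi_div_sub_le (by omega) hmod

lemma segment_equatorialVertex_polarVertex_inter_closedBall (hn : 2 < n) (i : ℕ) (σ : ℤˣ) :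
    (segment ℝ (equatorialVertex n i) (polarVertex n σ) ∩ closedBall 0 1).Nonempty := by
  rw [equatorialVertex_eq_smul]
  refine segment_secant_smul_inter_closedBall (pi_div_mem_Ioo hn)
    (pi_div_two_sub_pi_div_mem_Ioo hn) ?_
  rw [inner_equatorPoint_pole, add_sub_cancel, cos_pi_div_two]

lemma segment_polarVertex_polarVertex_inter_closedBall (hn : 2 < n) {σ τ : ℤˣ} (h : σ ≠ τ) :
    (segment ℝ (polarVertex n σ) (polarVertex n τ) ∩ closedBall 0 1).Nonempty := by
  refine segment_secant_smul_inter_closedBall (pi_div_two_sub_pi_div_mem_Ioo hn)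
    (pi_div_two_sub_pi_div_mem_Ioo hn) ?_
  rw [inner_pole_pole_of_ne h]
  exact neg_one_le_cos _

lemma isCapBody_bipyramidVertices (hn : 2 < n) :
    IsCapBody (closedBall 0 1) (bipyramidVertices n)
      (spikyBody (closedBall 0 1) (bipyramidVertices n)) := by
  refine ⟨(finite_bipyramidVertices n).countable, Set.disjoint_left.2 fun v hv => ?_,
    fun v hv w hw hvw => ?_, rfl⟩
  · obtain ⟨i, -, rfl⟩ | ⟨σ, rfl⟩ := (mem_bipyramidVertices (by omega)).1 hv
    · rw [equatorialVertex_eq_smul]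
      exact secant_smul_notMem_closedBall (pi_div_mem_Ioo hn)
    · exact secant_smul_notMem_closedBall (pi_div_two_sub_pi_div_mem_Ioo hn)
  · obtain ⟨i, hi, rfl⟩ | ⟨σ, rfl⟩ := (mem_bipyramidVertices (by omega)).1 hv <;>
      obtain ⟨j, hj, rfl⟩ | ⟨τ, rfl⟩ := (mem_bipyramidVertices (by omega)).1 hw
    · exact segment_equatorialVertex_equatorialVertex_inter_closedBall hn hi hj
        (ne_of_apply_ne _ hvw)
    · exact segment_equatorialVertex_polarVertex_inter_closedBall hn i τ
    · rw [segment_symm]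
      exact segment_equatorialVertex_polarVertex_inter_closedBall hn j σ
    · exact segment_polarVertex_polarVertex_inter_closedBall hn (ne_of_apply_ne _ hvw)

lemma not_illuminates_polarVertex_of_ne (hn : 2 < n) {σ τ : ℤˣ} (hστ : σ ≠ τ)
    (hu : Illuminates (closedBall 0 1) u (polarVertex n σ)) :
    ¬ Illuminates (closedBall 0 1) u (polarVertex n τ) := by
  have hα := Set.Ioo_subset_Ico_self (pi_div_two_sub_pi_div_mem_Ioo hn)
  refine not_illuminates_closedBall_of_inner_le hα hα ?_ hu
  rw [inner_pole_pole_of_ne hστ]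
  exact neg_le_neg (cos_le_one _)

lemma not_illuminates_equatorialVertex_of_illuminates_polarVertex (hn : 2 < n) {σ : ℤˣ} (i : ℕ)
    (hu : Illuminates (closedBall 0 1) u (polarVertex n σ)) :
    ¬ Illuminates (closedBall 0 1) u (equatorialVertex n i) := by
  rw [equatorialVertex_eq_smul]
  refine not_illuminates_closedBall_of_inner_le
    (Set.Ioo_subset_Ico_self (pi_div_two_sub_pi_div_mem_Ioo hn))
    (Set.Ioo_subset_Ico_self (pi_div_mem_Ioo hn)) ?_ hu
  rw [real_inner_comm, inner_equatorPoint_pole, sub_add_cancel, cos_pi_div_two, neg_zero]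

open Classical in
lemma card_filter_illuminates_equatorialVertex_le (hn : 2 < n)
    (u : sphere (0 : EuclideanSpace ℝ (Fin 3)) 1) :
    ((Finset.Icc 1 n).filter fun i : ℕ =>
      Illuminates (closedBall 0 1) u (equatorialVertex n i)).card ≤ (n - 1) / 2 := by
  simp only [illuminates_closedBall_equatorialVertex_iff hn]
  convert card_filter_sin_lt_neg_inner_equatorPoint_le hn.le u

open Classical in
lemma IsMultiIlluminated.exists_mul_le_and_add_le_card (hn : 2 < n)
    {U : Multiset (sphere (0 : EuclideanSpace ℝ (Fin 3)) 1)}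
    (hU : IsMultiIlluminated m (spikyBody (closedBall 0 1) (bipyramidVertices n)) U) :
    ∃ c, m * n ≤ c * ((n - 1) / 2) ∧ 2 * m + c ≤ U.card := by
  have hvertex (v) (hv : v ∈ bipyramidVertices n) :
      m ≤ U.countP fun u => Illuminates (closedBall 0 1) u v :=
    (isCapBody_bipyramidVertices hn).le_countP_illuminates (convex_closedBall 0 1)
      ⟨0, by simp [interior_closedBall]⟩ hU hv
  have hequatorial (i) (hi : i ∈ Finset.Icc 1 n) :=
    hvertex _ ((mem_bipyramidVertices (by omega)).2 (Or.inl ⟨i, Finset.mem_Icc.1 hi, rfl⟩))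
  have hpolar (σ : ℤˣ) := hvertex _ ((mem_bipyramidVertices (by omega)).2 (Or.inr ⟨σ, rfl⟩))
  have hmul := calc
    m * n = ∑ _ ∈ Finset.Icc 1 n, m := by simp [mul_comm]
    _ ≤ ∑ i ∈ Finset.Icc 1 n,
        U.countP fun u => Illuminates (closedBall 0 1) u (equatorialVertex n i) :=
      Finset.sum_le_sum hequatorial
    _ ≤ _ := sum_countP_le_mul_countP_exists U _ _
      (card_filter_illuminates_equatorialVertex_le hn)
    _ = _ := mul_comm _ _
  refine ⟨_, hmul, ?_⟩
  rw [two_mul]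
  refine (Nat.add_le_add_right (add_le_add (hpolar 1) (hpolar (-1))) _).trans
    (countP_add_countP_add_countP_le_card U
      (fun _ => not_illuminates_polarVertex_of_ne hn (by decide)) ?_ ?_) <;>
    exact fun _ hu ⟨i, _, hi⟩ =>
      not_illuminates_equatorialVertex_of_illuminates_polarVertex hn i hu hi

/-- `m` copies of each pole together with `N` directions on the equator, each opposite to the centre
of one of `N` consecutive blocks of `(n - 1) / 2` vertices, the largest size of a block that can be
illuminated by one direction. -/
noncomputable def bipyramidDirections (m n N : ℕ) :
    Multiset (sphere (0 : EuclideanSpace ℝ (Fin 3)) 1) :=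
  ∑ σ : ℤˣ, Multiset.replicate m (pole σ) +
    (Multiset.range N).map fun j => -equatorPoint (blockAngle n ((n - 1) / 2) j)

lemma card_bipyramidDirections (m n N : ℕ) : (bipyramidDirections m n N).card = 2 * m + N := by
  simp [bipyramidDirections, two_mul]

section CountP

variable {N : ℕ} {p : sphere (0 : EuclideanSpace ℝ (Fin 3)) 1 → Prop} [DecidablePred p]

lemma le_countP_bipyramidDirections_of_pole {σ : ℤˣ} (hσ : p (pole σ)) :
    m ≤ (bipyramidDirections m n N).countP p := by
  have hle : Multiset.replicate m (pole σ) ≤ bipyramidDirections m n N :=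
    (Finset.single_le_sum (fun _ _ => Multiset.zero_le _) (Finset.mem_univ σ)).trans
      (Multiset.le_add_right _ _)
  calc m = (Multiset.replicate m (pole σ)).countP p := by
        rw [Multiset.countP_eq_card.2 fun a ha => (Multiset.eq_of_mem_replicate ha).symm ▸ hσ,
          Multiset.card_replicate]
    _ ≤ _ := Multiset.countP_le_of_le p hle

open Classical in
lemma le_countP_bipyramidDirections_of_equatorPoint (hn : 2 < n) (hN : m * n ≤ N * ((n - 1) / 2))
    (i : ℤ) (hp : ∀ θ, sin (π / n) < cos (θ - 2 * i * π / n) → p (-equatorPoint θ)) :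
    m ≤ (bipyramidDirections m n N).countP p := by
  refine (le_card_filter_sin_lt_cos_blockAngle_sub (by omega) (by omega) hN i).trans
    (le_trans ?_ (Multiset.countP_le_of_le p (Multiset.le_add_left _ _)))
  rw [Multiset.countP_map]
  exact Multiset.card_le_card (Multiset.monotone_filter_right _ fun _ => hp _)

end CountP

lemma exists_int_one_le_inner_secant_smul_equatorPoint (hn : 2 < n) (φ : ℝ) :
    ∃ i : ℤ, 1 ≤ inner ℝ
      (secant (π / n) • (equatorPoint (2 * i * π / n) : EuclideanSpace ℝ (Fin 3)))
      (equatorPoint φ : EuclideanSpace ℝ (Fin 3)) := by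
  obtain ⟨hα, hα'⟩ := pi_div_mem_Ioo hn
  have hcos : 0 < cos (π / n) := cos_pos_of_mem_Ioo ⟨by linarith, hα'⟩
  refine ⟨round (φ / (2 * (π / n))), ?_⟩
  have hround := abs_sub_round (φ / (2 * (π / n)))
  rw [real_inner_smul_left, inner_equatorPoint_equatorPoint, secant, one_div_mul_eq_div,
    one_le_div hcos, ← cos_abs (_ - φ)]
  refine cos_le_cos_of_nonneg_of_le_pi (abs_nonneg _) (by linarith) ?_
  calc |2 * (round (φ / (2 * (π / n))) : ℝ) * π / n - φ|
      = 2 * (π / n) * |φ / (2 * (π / n)) - round (φ / (2 * (π / n)))| := by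
        rw [← abs_of_pos (mul_pos two_pos hα), ← abs_mul, mul_sub, abs_of_pos (mul_pos two_pos hα),
          mul_div_cancel₀ _ (mul_pos two_pos hα).ne', abs_sub_comm]
        congr 2
        ring
    _ ≤ 2 * (π / n) * (1 / 2) := by gcongr
    _ = π / n := by ring

lemma isMultiIlluminated_closedBall_bipyramidDirections {N : ℕ} (hn : 2 < n)
    (hN : m * n ≤ N * ((n - 1) / 2)) :
    IsMultiIlluminated m (closedBall 0 1) (bipyramidDirections m n N) := by
  classical
  intro p hp
  rw [frontier_closedBall _ one_ne_zero] at hp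
  obtain hz | hz := eq_or_ne (p 2) 0
  · obtain ⟨φ, rfl⟩ := exists_eq_equatorPoint (norm_eq_of_mem_sphere ⟨p, hp⟩) hz
    obtain ⟨i, hi⟩ := exists_int_one_le_inner_secant_smul_equatorPoint hn φ
    refine le_countP_bipyramidDirections_of_equatorPoint hn hN i fun θ hθ =>
      Illuminates.closedBall_of_one_le_inner ?_ hi
    rw [illuminates_closedBall_secant_smul_iff (Set.Ioo_subset_Ico_self (pi_div_mem_Ioo hn))]
    simpa [inner_equatorPoint_equatorPoint] using hθ
  · obtain ⟨σ, hσ⟩ : ∃ σ : ℤˣ, ((σ : ℤ) : ℝ) * p 2 < 0 := by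
      obtain hneg | hpos := hz.lt_or_gt
      · exact ⟨1, by simpa using hneg⟩
      · exact ⟨-1, by simpa using hpos⟩
    refine le_countP_bipyramidDirections_of_pole (σ := σ) ?_
    rw [illuminates_closedBall_coe_iff (e := ⟨p, hp⟩), real_inner_comm, inner_pole_right]
    exact hσ

lemma le_countP_bipyramidDirections_of_mem_bipyramidVertices {N : ℕ} (hn : 2 < n)
    (hN : m * n ≤ N * ((n - 1) / 2)) {v} (hv : v ∈ bipyramidVertices n)
    [DecidablePred fun u => Illuminates (closedBall 0 1) u v] :
    m ≤ (bipyramidDirections m n N).countP fun u => Illuminates (closedBall 0 1) u v := by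
  obtain ⟨i, -, rfl⟩ | ⟨σ, rfl⟩ := (mem_bipyramidVertices (by omega)).1 hv
  · refine le_countP_bipyramidDirections_of_equatorPoint hn hN i fun θ hθ => ?_
    rw [illuminates_closedBall_equatorialVertex_iff hn]
    simpa [inner_equatorPoint_equatorPoint] using hθ
  · refine le_countP_bipyramidDirections_of_pole (σ := -σ) ?_
    rw [polarVertex, illuminates_closedBall_secant_smul_iff
      (Set.Ioo_subset_Ico_self (pi_div_two_sub_pi_div_mem_Ioo hn)),
      inner_pole_pole_of_ne (neg_units_ne_self σ), neg_neg]
    exact (sin_lt_sin_of_lt_of_le_pi_div_two (by linarith [(pi_div_mem_Ioo hn).2, pi_pos]) le_rfl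
      (pi_div_two_sub_pi_div_mem_Ioo hn).2).trans_eq sin_pi_div_two

lemma isMultiIlluminated_bipyramidDirections {N : ℕ} (hn : 2 < n)
    (hN : m * n ≤ N * ((n - 1) / 2)) :
    IsMultiIlluminated m (spikyBody (closedBall 0 1) (bipyramidVertices n))
      (bipyramidDirections m n N) := by
  classical
  exact isMultiIlluminated_spikyBody (convex_closedBall 0 1) (isCompact_closedBall 0 1)
    (nonempty_closedBall.2 zero_le_one) (finite_bipyramidVertices n)
    ⟨_, (mem_bipyramidVertices (by omega)).2 (Or.inr ⟨1, rfl⟩)⟩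
    (isMultiIlluminated_closedBall_bipyramidDirections hn hN)
    fun _ hv => le_countP_bipyramidDirections_of_mem_bipyramidVertices hn hN hv

lemma floor_natCast_sub_one_div_two (hn : 0 < n) : ⌊((n : ℝ) - 1) / 2⌋₊ = (n - 1) / 2 := by
  rw [← Nat.cast_pred hn, ← Nat.cast_two, Nat.floor_div_eq_div]

end Bipyramid

theorem mainTheorem11 (m n : ℕ) (hm : 1 ≤ m) (hn : 3 ≤ n) :
    IsCapBody (Metric.closedBall (0 : EuclideanSpace ℝ (Fin 3)) 1) (bipyramidVertices n)
        (spikyBody (Metric.closedBall 0 1) (bipyramidVertices n)) ∧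
      illuminationNumber m
          (spikyBody (Metric.closedBall (0 : EuclideanSpace ℝ (Fin 3)) 1) (bipyramidVertices n)) =
        ((2 * m + ⌈((m : ℝ) * n) / (⌊((n : ℝ) - 1) / 2⌋₊ : ℝ)⌉₊ : ℕ) : ℕ∞) := by
  refine ⟨isCapBody_bipyramidVertices hn, ?_⟩
  have hk : 0 < (n - 1) / 2 := by omega
  have hk' : (0 : ℝ) < ((n - 1) / 2 : ℕ) := by exact_mod_cast hk
  rw [floor_natCast_sub_one_div_two (by omega)]
  refine le_antisymm ?_ (le_iInf₂ fun U hU => ?_)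
  · refine (iInf₂_le _ (isMultiIlluminated_bipyramidDirections hn ?_)).trans_eq
      (congrArg Nat.cast (card_bipyramidDirections m n _))
    exact_mod_cast (div_le_iff₀ hk').1 (Nat.le_ceil (((m : ℝ) * n) / ((n - 1) / 2 : ℕ)))
  · obtain ⟨c, hmul, hcard⟩ := hU.exists_mul_le_and_add_le_card hn
    have hceil : ⌈((m : ℝ) * n) / ((n - 1) / 2 : ℕ)⌉₊ ≤ c :=
      Nat.ceil_le.2 ((div_le_iff₀ hk').2 (by exact_mod_cast hmul))
    exact_mod_cast (add_le_add_right hceil (2 * m)).trans hcard
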